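/- Let $\alpha,\beta\in(0,1)$. Let $\mathfrak A^{\alpha}$ and $\mathfrak A^{\beta}$ be independent stable subordinators of orders $\alpha$ and $\beta$, i.e. Lévy processes with non-decreasing right-continuous paths, started at $0$, with $\mathbb E e^{-\xi \mathfrak A^{\gamma}_t}=e^{-t\xi^{\gamma}}$ for $\xi,t\ge 0$ and $\gamma\in\{\alpha,\beta\}$. For $t>0$ let $\mathfrak L^{\gamma}_t=\inf\{s\ge 0:\mathfrak A^{\gamma}_s>t\}$ be the inverse processes, and put $$\mathfrak F^{\alpha,\beta}_t=\mathfrak A^{\alpha}_{\mathfrak L^{\beta}_t},\qquad \mathfrak F^{\beta,\alpha}_t=\mathfrak A^{\beta}_{\mathfrak L^{\alpha}_t},\qquad \mathcal T^{\alpha,\beta}_t=\inf\{s>0:\mathfrak F^{\alpha,\beta}_s\notin(0,t)\},\qquad t>0 .$$ Then the processes $(\mathcal T^{\alpha,\beta}_t)_{t>0}$ and $(\mathfrak F^{\beta,\alpha}_t)_{t>0}$ have the same finite-dimensional distributions, that is, for all $n$ and all $t_1,\dots,t_n>0$, $$(\mathcal T^{\alpha,\beta}_{t_1},\dots,\mathcal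 T^{\alpha,\beta}_{t_n})\overset{law}{=}(\mathfrak F^{\beta,\alpha}_{t_1},\dots,\mathfrak F^{\beta,\alpha}_{t_n}).$$ Here $\mathfrak F^{\alpha,\beta}$ and $\mathfrak F^{\beta,\alpha}$ may be built from different independent pairs of stable subordinators, possibly on different probability spaces. -/

import Mathlib

open MeasureTheory ProbabilityTheory
open scoped NNReal

/-- `A` is a subordinator under `P`: a real-valued Lévy process with non-decreasing
paths. It starts at `0`, has stationary independent increments, and its paths are almost
surely non-decreasing and right-continuous (hence càdlàg). -/
structure IsSubordinator {Ω : Type*} [MeasurableSpace Ω] (A : ℝ≥0 → Ω → ℝ)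
    (P : Measure Ω) : Prop where
  measurable : ∀ t, Measurable (A t)
  zero : ∀ᵐ ω ∂P, A 0 ω = 0
  indep_increments : HasIndepIncrements A P
  stationary_increments : ∀ s t : ℝ≥0,
    IdentDistrib (fun ω => A (s + t) ω - A s ω) (A t) P P
  monotone_paths : ∀ᵐ ω ∂P, Monotone (fun t => A t ω)
  right_continuous_paths : ∀ᵐ ω ∂P, ∀ t : ℝ≥0,
    ContinuousWithinAt (fun s => A s ω) (Set.Ici t) t

/-- `A` is an `α`-stable subordinator: a subordinator with
`𝔼 exp (-ξ A_t) = exp (-t ξ ^ α)` for `ξ ≥ 0`. -/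
structure IsStableSubordinator {Ω : Type*} [MeasurableSpace Ω] (α : ℝ) (A : ℝ≥0 → Ω → ℝ)
    (P : Measure Ω) : Prop extends IsSubordinator A P where
  laplace : ∀ (t : ℝ≥0) (ξ : ℝ), 0 ≤ ξ →
    ∫ ω, Real.exp (-ξ * A t ω) ∂P = Real.exp (-(t : ℝ) * ξ ^ α)

/-- The inverse process `L_t = inf {s ≥ 0 : B_s > t}`. -/
noncomputable def inverseProcess {Ω : Type*} (B : ℝ≥0 → Ω → ℝ) (t : ℝ≥0) (ω : Ω) : ℝ≥0 :=
  sInf {s : ℝ≥0 | (t : ℝ) < B s ω}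

/-- The process `A` run with the clock `L` inverse to `B`, that is `F_t = A_{L_t}`. -/
noncomputable def timeChange {Ω : Type*} (A B : ℝ≥0 → Ω → ℝ) (t : ℝ≥0) (ω : Ω) : ℝ :=
  A (inverseProcess B t ω) ω

/-- The exit time of the process `(X_s)`, `s > 0`, from the interval `(0, t)`, with value
`⊤` (that is, `+∞`) if there is no exit. -/
noncomputable def exitTime {Ω : Type*} (X : ℝ≥0 → Ω → ℝ) (t : ℝ≥0) (ω : Ω) : EReal :=
  ⨅ s ∈ {s : ℝ≥0 | 0 < s ∧ X s ω ∉ Set.Ioo (0 : ℝ) t}, ((s : ℝ) : EReal)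

/-! Let `L_t` be the first passage time of `A` above `t`. On almost every path, `B` run with the
clock inverse to `A` is `B (L_t)`, whereas inverting both monotone paths shows that the exit time of
`timeChange A B` is the left limit of `B` at `L_t`. The two differ only if `B` jumps at `L_t`. But
`L_t` is a functional of `A`, hence independent of `B`, and `B` has no fixed jump times, so they
agree almost surely (`firstPassageSup_ae_eq_firstPassageInf`).

The value at `L_t` and the left limit are encoded by `firstPassageInf` and `firstPassageSup`, which
use countably many coordinates and are thus measurable on path space. Both processes of the theorem
become the same functional of a pair of paths, and the law of the pair does not depend on the
probability space: Laplace transforms fix the marginals, increments fix each process, independence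
fixes the pair. -/

open Filter Topology

/-! ### Path functionals -/

/-- The infimum of `b q` over the points `q` of a fixed countable dense set with `t < a q`. -/
noncomputable def firstPassageInf (t : ℝ≥0) (a b : ℝ≥0 → ℝ) : EReal :=
  ⨅ n : ℕ, if (t : ℝ) < a (TopologicalSpace.denseSeq ℝ≥0 n)
    then (b (TopologicalSpace.denseSeq ℝ≥0 n) : EReal) else ⊤

/-- The supremum of `b q` over the points `q` of a fixed countable dense set with `a q < t`. -/
noncomputable def firstPassageSup (t : ℝ≥0) (a b : ℝ≥0 → ℝ) : EReal :=
  ⨆ n : ℕ, if a (TopologicalSpace.denseSeq ℝ≥0 n) < (t : ℝ)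
    then (b (TopologicalSpace.denseSeq ℝ≥0 n) : EReal) else ⊥

lemma measurable_firstPassageInf (t : ℝ≥0) :
    Measurable fun p : (ℝ≥0 → ℝ) × (ℝ≥0 → ℝ) => firstPassageInf t p.1 p.2 := by
  unfold firstPassageInf
  refine Measurable.iInf fun n => Measurable.ite ?_ ?_ measurable_const
  · exact measurableSet_lt measurable_const (by fun_prop)
  · exact measurable_coe_real_ereal.comp (by fun_prop)

lemma measurable_firstPassageSup (t : ℝ≥0) :
    Measurable fun p : (ℝ≥0 → ℝ) × (ℝ≥0 → ℝ) => firstPassageSup t p.1 p.2 := by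
  unfold firstPassageSup
  refine Measurable.iSup fun n => Measurable.ite ?_ ?_ measurable_const
  · exact measurableSet_lt (by fun_prop) measurable_const
  · exact measurable_coe_real_ereal.comp (by fun_prop)

/-- The properties shared by almost all paths of a stable subordinator. -/
structure IsSubordinatorPath (a : ℝ≥0 → ℝ) : Prop where
  zero : a 0 = 0
  strictMono : StrictMono a
  right_continuous : ∀ t, ContinuousWithinAt a (Set.Ici t) t
  unbounded : ∀ c : ℝ, ∃ s, c < a s

lemma exists_denseSeq_btwn {x y : ℝ≥0} (h : x < y) :
    ∃ n, x < TopologicalSpace.denseSeq ℝ≥0 n ∧ TopologicalSpace.denseSeq ℝ≥0 n < y := by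
  obtain ⟨_, ⟨n, rfl⟩, hn⟩ := (TopologicalSpace.denseRange_denseSeq ℝ≥0).exists_between h
  exact ⟨n, hn⟩

lemma exists_denseSeq_gt_of_continuousWithinAt {a : ℝ≥0 → ℝ} {x : ℝ≥0} {c : ℝ}
    (ha : ContinuousWithinAt a (Set.Ici x) x) (hc : a x < c) :
    ∃ n, x < TopologicalSpace.denseSeq ℝ≥0 n ∧ a (TopologicalSpace.denseSeq ℝ≥0 n) < c := by
  have h : ∀ᶠ y in 𝓝[≥] x, a y < c := ha.eventually_lt_const hc
  obtain ⟨u, hu, hsub⟩ := mem_nhdsGE_iff_exists_Ico_subset.1 h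
  obtain ⟨n, h1, h2⟩ := exists_denseSeq_btwn (Set.mem_Ioi.1 hu)
  exact ⟨n, h1, hsub ⟨h1.le, h2⟩⟩

namespace IsSubordinatorPath

variable {a b : ℝ≥0 → ℝ}

lemma lt_of_sInf_lt (ha : IsSubordinatorPath a) {t : ℝ} {q : ℝ≥0}
    (hq : sInf {s : ℝ≥0 | t < a s} < q) : t < a q := by
  obtain ⟨s, hs, hsq⟩ := exists_lt_of_csInf_lt (ha.unbounded t) hq
  exact lt_trans hs (ha.strictMono hsq)

lemma le_sInf_of_le (ha : IsSubordinatorPath a) {t : ℝ} {q : ℝ≥0} (hq : a q ≤ t) :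
    q ≤ sInf {s : ℝ≥0 | t < a s} :=
  le_csInf (ha.unbounded t) fun _ hs => (ha.strictMono.lt_iff_lt.1 (hq.trans_lt hs)).le

lemma sInf_pos (ha : IsSubordinatorPath a) {t : ℝ} (ht : 0 < t) :
    0 < sInf {s : ℝ≥0 | t < a s} := by
  obtain ⟨n, hn, hlt⟩ := exists_denseSeq_gt_of_continuousWithinAt
    (ha.right_continuous 0) (ha.zero.trans_lt ht)
  exact hn.trans_le (ha.le_sInf_of_le hlt.le)

/-- Every dense point beyond the passage time has `a q > t`, and right continuity of `b` makes the
values at such points approach the value at the passage time. -/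
lemma apply_sInf_eq_firstPassageInf (ha : IsSubordinatorPath a) (hb : IsSubordinatorPath b)
    (t : ℝ≥0) : (b (sInf {s : ℝ≥0 | (t : ℝ) < a s}) : EReal) = firstPassageInf t a b := by
  apply le_antisymm
  · refine le_iInf fun n => ?_
    split_ifs with h
    · exact EReal.coe_le_coe_iff.2 (hb.strictMono.monotone (csInf_le' h))
    · exact le_top
  · refine EReal.le_of_forall_lt_iff_le.1 fun c hc => ?_
    obtain ⟨n, hn, hlt⟩ := exists_denseSeq_gt_of_continuousWithinAt (hb.right_continuous _)
      (EReal.coe_lt_coe_iff.1 hc)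
    refine (iInf_le _ n).trans ?_
    rw [if_pos (ha.lt_of_sInf_lt hn)]
    exact EReal.coe_le_coe_iff.2 hlt.le

/-- For monotone `b`, `hleft` says that `b` does not jump at the passage time. -/
lemma firstPassageSup_eq_apply_sInf (ha : IsSubordinatorPath a) (hb : IsSubordinatorPath b)
    (t : ℝ≥0) (hleft : ∀ c < b (sInf {s : ℝ≥0 | (t : ℝ) < a s}),
      ∃ v < sInf {s : ℝ≥0 | (t : ℝ) < a s}, c < b v) :
    firstPassageSup t a b = (b (sInf {s : ℝ≥0 | (t : ℝ) < a s}) : EReal) := by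
  apply le_antisymm
  · refine iSup_le fun n => ?_
    split_ifs with h
    · exact EReal.coe_le_coe_iff.2 (hb.strictMono.monotone (ha.le_sInf_of_le h.le))
    · exact bot_le
  · refine EReal.ge_of_forall_gt_iff_ge.1 fun c hc => ?_
    obtain ⟨v, hv, hcv⟩ := hleft c (EReal.coe_lt_coe_iff.1 hc)
    obtain ⟨n, hvn, hn⟩ := exists_denseSeq_btwn hv
    -- Before the passage time only `a ≤ t` is known; the extra point `r` and strict monotonicity
    -- give the strict inequality at the dense point.
    obtain ⟨r, hnr, hr⟩ := exists_between hn
    have har : a r ≤ t := not_lt.1 fun h => hr.not_ge (csInf_le (OrderBot.bddBelow _) h)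
    refine le_trans ?_ (le_iSup _ n)
    rw [if_pos ((ha.strictMono hnr).trans_le har)]
    exact EReal.coe_le_coe_iff.2 (hcv.trans (hb.strictMono hvn)).le

end IsSubordinatorPath

/-- The time-changed path is positive at positive times, so it can leave the interval only by
reaching `t` or more. No continuity from the left is needed here. -/
lemma exitTime_timeChange_eq_firstPassageSup {Ω : Type*} {A B : ℝ≥0 → Ω → ℝ} {ω : Ω}
    (hA : IsSubordinatorPath (A · ω)) (hB : IsSubordinatorPath (B · ω)) {t : ℝ≥0} (ht : 0 < t) :
    exitTime (timeChange A B) t ω = firstPassageSup t (A · ω) (B · ω) := by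
  have hexit : ∀ s : ℝ≥0, 0 < s →
      (timeChange A B s ω ∉ Set.Ioo (0 : ℝ) t ↔ (t : ℝ) ≤ timeChange A B s ω) := by
    intro s hs
    have : 0 < timeChange A B s ω := by
      have := hA.strictMono (hB.sInf_pos (NNReal.coe_pos.2 hs))
      exact hA.zero.symm.trans_lt this
    simp [this]
  apply le_antisymm
  · refine EReal.le_of_forall_lt_iff_le.1 fun c hc => ?_
    have hbc : ∀ n, A (TopologicalSpace.denseSeq ℝ≥0 n) ω < t →
        B (TopologicalSpace.denseSeq ℝ≥0 n) ω < c := by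
      intro n hn
      have := (le_iSup (fun n => if A (TopologicalSpace.denseSeq ℝ≥0 n) ω < (t : ℝ)
        then (B (TopologicalSpace.denseSeq ℝ≥0 n) ω : EReal) else ⊥) n).trans_lt hc
      rw [if_pos hn] at this
      exact EReal.coe_lt_coe_iff.1 this
    have hc0 : 0 < c := by
      obtain ⟨n, hn, hlt⟩ := exists_denseSeq_gt_of_continuousWithinAt
        (hA.right_continuous 0) (hA.zero.trans_lt (NNReal.coe_pos.2 ht))
      have := hB.strictMono hn
      simp only [hB.zero] at this
      exact this.trans (hbc n hlt)
    lift c to ℝ≥0 using hc0.le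
    refine iInf₂_le c ⟨NNReal.coe_pos.1 hc0, (hexit c (NNReal.coe_pos.1 hc0)).2 ?_⟩
    -- If the path were still below `t` at time `c`, right continuity of `A` would give a dense `q`
    -- past the passage of `B` above `c` with `A q < t`; then `B q > c`, against `hbc`.
    by_contra! hlt
    obtain ⟨n, hn, hAn⟩ := exists_denseSeq_gt_of_continuousWithinAt (hA.right_continuous _) hlt
    exact (hB.lt_of_sInf_lt hn).not_gt (hbc n hAn)
  · refine le_iInf₂ fun s hs => iSup_le fun n => ?_
    split_ifs with h
    · have h1 := (hexit s hs.1).1 hs.2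
      have h2 := hA.strictMono.lt_iff_lt.1 (h.trans_le h1)
      exact EReal.coe_le_coe_iff.2 (not_lt.1 fun h3 =>
        h2.not_ge (csInf_le (OrderBot.bddBelow _) h3))
    · exact bot_le

/-! ### Determination of laws by Laplace transforms -/

section Laplace

variable {Ω Ω' : Type*} [MeasurableSpace Ω] [MeasurableSpace Ω'] {P : Measure Ω} {P' : Measure Ω'}

lemma integrableExpSet_eq_univ_of_mem_Icc [IsFiniteMeasure P] {X : Ω → ℝ} {a b : ℝ}
    (hX : AEMeasurable X P) (h : ∀ᵐ ω ∂P, X ω ∈ Set.Icc a b) :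
    integrableExpSet X P = Set.univ :=
  Set.eq_univ_of_forall fun _ => integrable_exp_mul_of_mem_Icc hX h

lemma differentiable_complexMGF_of_mem_Icc [IsFiniteMeasure P] {X : Ω → ℝ} {a b : ℝ}
    (hX : AEMeasurable X P) (h : ∀ᵐ ω ∂P, X ω ∈ Set.Icc a b) :
    Differentiable ℂ (complexMGF X P) := fun z =>
  (analyticAt_complexMGF (by simp [integrableExpSet_eq_univ_of_mem_Icc hX h])).differentiableAt

lemma iteratedDeriv_complexMGF_zero_of_mem_Icc [IsFiniteMeasure P] {X : Ω → ℝ} {a b : ℝ}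
    (hX : AEMeasurable X P) (h : ∀ᵐ ω ∂P, X ω ∈ Set.Icc a b) (n : ℕ) :
    iteratedDeriv n (complexMGF X P) 0 = ((∫ ω, X ω ^ n ∂P : ℝ) : ℂ) := by
  rw [iteratedDeriv_complexMGF (by simp [integrableExpSet_eq_univ_of_mem_Icc hX h]),
    ← integral_complex_ofReal]
  simp

/-- Bounded random variables with the same moments have the same law. -/
lemma map_eq_of_moments_eq [IsFiniteMeasure P] [IsFiniteMeasure P'] {X : Ω → ℝ} {Y : Ω' → ℝ}
    {a b : ℝ} (hX : AEMeasurable X P) (hY : AEMeasurable Y P')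
    (hXb : ∀ᵐ ω ∂P, X ω ∈ Set.Icc a b) (hYb : ∀ᵐ ω ∂P', Y ω ∈ Set.Icc a b)
    (h : ∀ n : ℕ, ∫ ω, X ω ^ n ∂P = ∫ ω, Y ω ^ n ∂P') : P.map X = P'.map Y := by
  refine Measure.ext_of_complexMGF_eq hX hY (funext fun z => ?_)
  -- For bounded variables the complex moment generating function is entire, with the moments as its
  -- derivatives at `0`.
  rw [← Complex.taylorSeries_eq_of_entire' 0 z (differentiable_complexMGF_of_mem_Icc hX hXb),
    ← Complex.taylorSeries_eq_of_entire' 0 z (differentiable_complexMGF_of_mem_Icc hY hYb)]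
  simp only [iteratedDeriv_complexMGF_zero_of_mem_Icc hX hXb,
    iteratedDeriv_complexMGF_zero_of_mem_Icc hY hYb, h]

/-- Nonnegative random variables whose Laplace transforms agree on `ℕ` have the same law. -/
lemma identDistrib_of_laplace_eq [IsFiniteMeasure P] [IsFiniteMeasure P'] {X : Ω → ℝ} {Y : Ω' → ℝ}
    (hX : Measurable X) (hY : Measurable Y) (hX0 : ∀ᵐ ω ∂P, 0 ≤ X ω) (hY0 : ∀ᵐ ω ∂P', 0 ≤ Y ω)
    (h : ∀ n : ℕ, ∫ ω, Real.exp (-n * X ω) ∂P = ∫ ω, Real.exp (-n * Y ω) ∂P') :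
    IdentDistrib X Y P P' := by
  -- The `n`-th moment of the bounded variable `exp (-X)` is the Laplace transform of `X` at `n`.
  have key : IdentDistrib (fun ω => Real.exp (-X ω)) (fun ω => Real.exp (-Y ω)) P P' := by
    refine ⟨by fun_prop, by fun_prop, map_eq_of_moments_eq (a := 0) (b := 1)
      (by fun_prop) (by fun_prop) ?_ ?_ fun n => ?_⟩
    · filter_upwards [hX0] with ω hω using ⟨(Real.exp_pos _).le, by simpa using hω⟩
    · filter_upwards [hY0] with ω hω using ⟨(Real.exp_pos _).le, by simpa using hω⟩
    · simpa [← Real.exp_nat_mul] using h n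
  simpa [Function.comp_def] using key.comp (u := fun x => -Real.log x) (by fun_prop)

end Laplace

/-! ### Laws of stable subordinators -/

section StableSubordinators

variable {Ω Ω' : Type*} [MeasurableSpace Ω] [MeasurableSpace Ω'] {P : Measure Ω} {P' : Measure Ω'}

/-- Puts finitely many times on a monotone sequence from `0`, so that the values there are partial
sums of independent increments. -/
lemma exists_monotone_nat_of_finset (I : Finset ℝ≥0) :
    ∃ (τ : ℕ → ℝ≥0) (r : I → ℕ), Monotone τ ∧ τ 0 = 0 ∧ ∀ x, τ (r x) = x := by
  have hcard : ∀ {x y : ℝ≥0}, x ∈ I → x < y →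
      (I.filter (· < x)).card < (I.filter (· < y)).card := by
    intro x y hx hxy
    refine Finset.card_lt_card ⟨?_, fun h => ?_⟩
    · intro z hz
      simp only [Finset.mem_filter] at hz ⊢
      exact ⟨hz.1, hz.2.trans hxy⟩
    · have := h (Finset.mem_filter.2 ⟨hx, hxy⟩)
      simp at this
  -- `τ k` is the largest point of `I` with fewer than `k` predecessors; the empty supremum gives `τ
  -- 0 = 0`, whence the shift by one in `r`.
  refine ⟨fun k => (I.filter fun x => (I.filter (· < x)).card < k).sup id,
    fun x => (I.filter (· < (x : ℝ≥0))).card + 1, ?_, ?_, ?_⟩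
  · intro k l hkl
    refine Finset.sup_mono fun x hx => ?_
    simp only [Finset.mem_filter] at hx ⊢
    exact ⟨hx.1, hx.2.trans_le hkl⟩
  · simp
  · intro x
    apply le_antisymm
    · refine Finset.sup_le fun y hy => ?_
      simp only [Finset.mem_filter] at hy
      exact not_lt.1 fun hxy => absurd (hcard x.2 hxy) (Nat.lt_succ_iff.1 hy.2).not_gt
    · exact Finset.le_sup (f := id) (Finset.mem_filter.2 ⟨x.2, Nat.lt_succ_self _⟩)

/-- Processes started at `0` with stationary independent increments and the same one-dimensional
marginals have the same law. -/
lemma IsSubordinator.identDistrib_of_forall_identDistrib [IsProbabilityMeasure P]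
    [IsProbabilityMeasure P'] {A : ℝ≥0 → Ω → ℝ} {A' : ℝ≥0 → Ω' → ℝ}
    (hA : IsSubordinator A P) (hA' : IsSubordinator A' P')
    (h : ∀ t, IdentDistrib (A t) (A' t) P P') :
    IdentDistrib (fun ω t => A t ω) (fun ω t => A' t ω) P P' := by
  have hm : Measurable fun ω t => A t ω := measurable_pi_lambda _ hA.measurable
  have hm' : Measurable fun ω t => A' t ω := measurable_pi_lambda _ hA'.measurable
  refine ⟨hm.aemeasurable, hm'.aemeasurable, ?_⟩
  have hfdd : ∀ I : Finset ℝ≥0, P.map (fun ω => I.restrict (A · ω)) =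
      P'.map (fun ω => I.restrict (A' · ω)) := by
    intro I
    obtain ⟨τ, r, hτ, hτ0, hr⟩ := exists_monotone_nat_of_finset I
    have hincr : IdentDistrib (fun ω (i : ℕ) => A (τ (i + 1)) ω - A (τ i) ω)
        (fun ω i => A' (τ (i + 1)) ω - A' (τ i) ω) P P' := by
      refine IdentDistrib.pi (fun i => ?_) (hA.indep_increments.nat hτ)
        (hA'.indep_increments.nat hτ)
      have hadd : τ i + (τ (i + 1) - τ i) = τ (i + 1) :=
        add_tsub_cancel_of_le (hτ (Nat.le_succ i))
      have h1 := hA.stationary_increments (τ i) (τ (i + 1) - τ i)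
      have h2 := hA'.stationary_increments (τ i) (τ (i + 1) - τ i)
      rw [hadd] at h1 h2
      exact (h1.trans (h _)).trans h2.symm
    have hsum := hincr.comp
      (u := fun (d : ℕ → ℝ) (x : I) => ∑ i ∈ Finset.range (r x), d i) (by fun_prop)
    have hsum_eq : ∀ x : ℝ≥0 → ℝ, x 0 = 0 →
        (fun i : I => ∑ j ∈ Finset.range (r i), (x (τ (j + 1)) - x (τ j))) = I.restrict x := by
      intro x h0
      ext i
      rw [Finset.sum_range_sub (fun j => x (τ j)), hr, hτ0, h0, sub_zero]
      rfl
    have h1 : (fun ω => I.restrict (A · ω)) =ᵐ[P]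
        fun ω i => ∑ j ∈ Finset.range (r i), (A (τ (j + 1)) ω - A (τ j) ω) := by
      filter_upwards [hA.zero] with ω hω using (hsum_eq (A · ω) hω).symm
    have h2 : (fun ω => I.restrict (A' · ω)) =ᵐ[P']
        fun ω i => ∑ j ∈ Finset.range (r i), (A' (τ (j + 1)) ω - A' (τ j) ω) := by
      filter_upwards [hA'.zero] with ω hω using (hsum_eq (A' · ω) hω).symm
    rw [Measure.map_congr h1, Measure.map_congr h2]
    exact hsum.map_eq
  have h1 := isProjectiveLimit_map (X := A) (P := P) hm.aemeasurable
  simp_rw [hfdd] at h1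
  have : ∀ I : Finset ℝ≥0, IsFiniteMeasure (P'.map fun ω => I.restrict (A' · ω)) := fun _ =>
    inferInstance
  exact h1.unique (isProjectiveLimit_map hm'.aemeasurable)

variable {α : ℝ} {A : ℝ≥0 → Ω → ℝ} {A' : ℝ≥0 → Ω' → ℝ}

lemma IsSubordinator.ae_nonneg (hA : IsSubordinator A P) : ∀ᵐ ω ∂P, ∀ t, 0 ≤ A t ω := by
  filter_upwards [hA.zero, hA.monotone_paths] with ω h0 hmono t
  rw [← h0]
  exact hmono zero_le

namespace IsStableSubordinator

lemma identDistrib [IsProbabilityMeasure P] [IsProbabilityMeasure P']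
    (hA : IsStableSubordinator α A P) (hA' : IsStableSubordinator α A' P') :
    IdentDistrib (fun ω t => A t ω) (fun ω t => A' t ω) P P' := by
  refine hA.toIsSubordinator.identDistrib_of_forall_identDistrib hA'.toIsSubordinator fun t => ?_
  refine identDistrib_of_laplace_eq (hA.measurable t) (hA'.measurable t) ?_ ?_ fun n => ?_
  · filter_upwards [hA.ae_nonneg] with ω h using h t
  · filter_upwards [hA'.ae_nonneg] with ω h using h t
  · rw [hA.laplace t n n.cast_nonneg, hA'.laplace t n n.cast_nonneg]

lemma integrable_exp [IsFiniteMeasure P] (hA : IsStableSubordinator α A P) (t : ℝ≥0) {ξ : ℝ}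
    (hξ : 0 ≤ ξ) : Integrable (fun ω => Real.exp (-ξ * A t ω)) P := by
  have := hA.measurable t
  refine Integrable.of_mem_Icc 0 1 (by fun_prop) ?_
  filter_upwards [hA.ae_nonneg] with ω h
  refine ⟨(Real.exp_pos _).le, Real.exp_le_one_iff.2 ?_⟩
  nlinarith [mul_nonneg hξ (h t)]

/-- Chernoff bound. Letting `ξ → ∞` with `c = 0` gives positivity; letting `t → ∞` with `ξ = 1`
gives unboundedness. -/
lemma measureReal_le [IsFiniteMeasure P] (hA : IsStableSubordinator α A P) (t : ℝ≥0) (c : ℝ)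
    {ξ : ℝ} (hξ : 0 ≤ ξ) :
    P.real {ω | A t ω ≤ c} ≤ Real.exp (ξ * c) * Real.exp (-(t : ℝ) * ξ ^ α) := by
  have hmark := mul_meas_ge_le_integral_of_nonneg
    (ae_of_all P fun ω => (Real.exp_pos (-ξ * A t ω)).le) (hA.integrable_exp t hξ)
    (Real.exp (-(ξ * c)))
  rw [hA.laplace t ξ hξ] at hmark
  have hsub : P.real {ω | A t ω ≤ c} ≤
      P.real {ω | Real.exp (-(ξ * c)) ≤ Real.exp (-ξ * A t ω)} := by
    refine measureReal_mono fun ω hω => Real.exp_le_exp.2 ?_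
    have := mul_le_mul_of_nonneg_left (show A t ω ≤ c from hω) hξ
    linarith
  calc P.real {ω | A t ω ≤ c}
      = Real.exp (ξ * c) * (Real.exp (-(ξ * c)) * P.real {ω | A t ω ≤ c}) := by
        rw [← mul_assoc, ← Real.exp_add]; simp
    _ ≤ _ := by gcongr; exact le_trans (by gcongr) hmark

lemma ae_pos [IsFiniteMeasure P] (hA : IsStableSubordinator α A P) (hα : 0 < α) {t : ℝ≥0}
    (ht : 0 < t) : ∀ᵐ ω ∂P, 0 < A t ω := by
  have hlim : Tendsto (fun ξ : ℝ => Real.exp (-(t : ℝ) * ξ ^ α)) atTop (𝓝 0) :=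
    Real.tendsto_exp_atBot.comp
      ((tendsto_rpow_atTop hα).const_mul_atTop_of_neg (neg_lt_zero.2 (NNReal.coe_pos.2 ht)))
  have hle : P.real {ω | A t ω ≤ 0} ≤ 0 := by
    refine ge_of_tendsto hlim ?_
    filter_upwards [eventually_ge_atTop 0] with ξ hξ
    simpa using hA.measureReal_le t 0 hξ
  have h0 := (measureReal_eq_zero_iff).1 (le_antisymm hle measureReal_nonneg)
  rw [ae_iff]
  simpa using h0

lemma ae_unbounded [IsFiniteMeasure P] (hA : IsStableSubordinator α A P) :
    ∀ᵐ ω ∂P, ∀ c : ℝ, ∃ s, c < A s ω := by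
  have key : ∀ k : ℕ, ∀ᵐ ω ∂P, ∃ s, (k : ℝ) < A s ω := by
    intro k
    have hlim : Tendsto (fun n : ℕ => Real.exp (k : ℝ) * Real.exp (-(n : ℝ))) atTop (𝓝 0) := by
      simpa using (Real.tendsto_exp_neg_atTop_nhds_zero.comp
        tendsto_natCast_atTop_atTop).const_mul (Real.exp (k : ℝ))
    have hle : P.real {ω | ¬∃ s, (k : ℝ) < A s ω} ≤ 0 := by
      refine ge_of_tendsto' hlim fun n => ?_
      refine le_trans (measureReal_mono (s₂ := {ω | A n ω ≤ k}) fun ω hω => ?_) ?_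
      · exact not_lt.1 fun h => hω ⟨_, h⟩
      · simpa using hA.measureReal_le n k zero_le_one
    exact ae_iff.2 ((measureReal_eq_zero_iff).1 (le_antisymm hle measureReal_nonneg))
  filter_upwards [ae_all_iff.2 key] with ω hω c
  obtain ⟨k, hk⟩ := exists_nat_gt c
  obtain ⟨s, hs⟩ := hω k
  exact ⟨s, hk.trans hs⟩

lemma ae_strictMono [IsFiniteMeasure P] (hA : IsStableSubordinator α A P) (hα : 0 < α) :
    ∀ᵐ ω ∂P, StrictMono fun t => A t ω := by
  have key : ∀ m n : ℕ, TopologicalSpace.denseSeq ℝ≥0 m < TopologicalSpace.denseSeq ℝ≥0 n →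
      ∀ᵐ ω ∂P, A (TopologicalSpace.denseSeq ℝ≥0 m) ω < A (TopologicalSpace.denseSeq ℝ≥0 n) ω := by
    intro m n hmn
    have hid := hA.stationary_increments (TopologicalSpace.denseSeq ℝ≥0 m)
      (TopologicalSpace.denseSeq ℝ≥0 n - TopologicalSpace.denseSeq ℝ≥0 m)
    rw [add_tsub_cancel_of_le hmn.le] at hid
    have := hid.symm.ae_mem_snd measurableSet_Ioi (hA.ae_pos hα (tsub_pos_of_lt hmn))
    filter_upwards [this] with ω hω using sub_pos.1 hω
  have key' : ∀ᵐ ω ∂P, ∀ m n : ℕ,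
      TopologicalSpace.denseSeq ℝ≥0 m < TopologicalSpace.denseSeq ℝ≥0 n →
      A (TopologicalSpace.denseSeq ℝ≥0 m) ω < A (TopologicalSpace.denseSeq ℝ≥0 n) ω := by
    simp_rw [ae_all_iff]
    exact key
  filter_upwards [key', hA.monotone_paths] with ω hω hmono s t hst
  obtain ⟨m, hsm, hmt⟩ := exists_denseSeq_btwn hst
  obtain ⟨n, hmn, hnt⟩ := exists_denseSeq_btwn hmt
  exact (hmono hsm.le).trans_lt ((hω m n hmn).trans_le (hmono hnt.le))

lemma ae_isSubordinatorPath [IsFiniteMeasure P] (hA : IsStableSubordinator α A P) (hα : 0 < α) :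
    ∀ᵐ ω ∂P, IsSubordinatorPath (A · ω) := by
  filter_upwards [hA.zero, hA.ae_strictMono hα, hA.right_continuous_paths, hA.ae_unbounded]
    with ω h0 h1 h2 h3 using ⟨h0, h1, h2, h3⟩

/-- A stable subordinator almost surely does not jump at a given time. -/
lemma ae_exists_lt_of_lt [IsFiniteMeasure P] (hA : IsStableSubordinator α A P) {u : ℝ≥0}
    (hu : 0 < u) : ∀ᵐ ω ∂P, ∀ c < A u ω, ∃ v < u, c < A v ω := by
  obtain ⟨v, hv_mono, hv_lt, hv_lim⟩ := exists_seq_strictMono_tendsto' hu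
  have hmeas := hA.measurable
  -- `S` is almost surely the left limit at `u`. The Laplace transform at `1` is continuous in time,
  -- so `S` and `A u` have equal integrals of `exp (-·)`; as `S ≤ A u`, they agree almost surely.
  set S : Ω → ℝ := fun ω => ⨆ n, A (v n) ω with hS
  have hSm : Measurable S := Measurable.iSup fun n => hmeas (v n)
  have hbdd : ∀ᵐ ω ∂P, BddAbove (Set.range fun n => A (v n) ω) := by
    filter_upwards [hA.monotone_paths] with ω hmono
    exact ⟨A u ω, by rintro _ ⟨n, rfl⟩; exact hmono (hv_lt n).2.le⟩
  have hSle : ∀ᵐ ω ∂P, S ω ≤ A u ω := by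
    filter_upwards [hA.monotone_paths] with ω hmono
    exact ciSup_le fun n => hmono (hv_lt n).2.le
  have hS0 : ∀ᵐ ω ∂P, 0 ≤ S ω := by
    filter_upwards [hA.ae_nonneg, hbdd] with ω h hb
    exact (h (v 0)).trans (le_ciSup hb 0)
  have hlim : Tendsto (fun n => ∫ ω, Real.exp (-1 * A (v n) ω) ∂P) atTop
      (𝓝 (∫ ω, Real.exp (-1 * S ω) ∂P)) := by
    refine tendsto_integral_of_dominated_convergence (fun _ => 1)
      (fun n => (hA.integrable_exp (v n) zero_le_one).aestronglyMeasurable)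
      (integrable_const 1) (fun n => ?_) ?_
    · filter_upwards [hA.ae_nonneg] with ω h
      simpa using h (v n)
    · filter_upwards [hA.monotone_paths, hbdd] with ω hmono hb
      have := tendsto_atTop_ciSup (fun m n hmn => hmono (hv_mono.monotone hmn)) hb
      exact (Real.continuous_exp.tendsto _).comp (this.const_mul (-1))
  have hint : ∫ ω, Real.exp (-1 * S ω) ∂P = ∫ ω, Real.exp (-1 * A u ω) ∂P := by
    refine tendsto_nhds_unique hlim ?_
    simp_rw [hA.laplace _ 1 zero_le_one, Real.one_rpow, mul_one]
    exact (Real.continuous_exp.tendsto _).comp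
      ((NNReal.continuous_coe.tendsto u).comp hv_lim).neg
  have hSint : Integrable (fun ω => Real.exp (-1 * S ω)) P := by
    refine Integrable.of_mem_Icc 0 1 (by fun_prop) ?_
    filter_upwards [hS0] with ω h
    exact ⟨(Real.exp_pos _).le, by simpa using h⟩
  have hle : (fun ω => Real.exp (-1 * A u ω)) ≤ᵐ[P] fun ω => Real.exp (-1 * S ω) := by
    filter_upwards [hSle] with ω h
    exact Real.exp_le_exp.2 (by linarith)
  have heq := (integral_eq_iff_of_ae_le (hA.integrable_exp u zero_le_one) hSint hle).1 hint.symm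
  filter_upwards [heq] with ω hω c hc
  have hSA : S ω = A u ω := by
    have := Real.exp_injective hω
    linarith
  obtain ⟨n, hn⟩ := exists_lt_of_lt_ciSup (hc.trans_eq hSA.symm)
  exact ⟨v n, (hv_lt n).2, hn⟩

end IsStableSubordinator

/-! ### The exit time as a time-changed process -/

variable {β : ℝ} {B : ℝ≥0 → Ω → ℝ}

lemma timeChange_ae_eq_firstPassageInf [IsFiniteMeasure P] (hα : 0 < α) (hβ : 0 < β)
    (hA : IsStableSubordinator α A P) (hB : IsStableSubordinator β B P) (t : ℝ≥0) :
    (fun ω => (timeChange B A t ω : EReal)) =ᵐ[P] fun ω => firstPassageInf t (A · ω) (B · ω) := by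
  filter_upwards [hA.ae_isSubordinatorPath hα, hB.ae_isSubordinatorPath hβ] with ω ha hb
  exact ha.apply_sInf_eq_firstPassageInf hb t

/-- By independence and Fubini the path of `A` can be frozen; its passage time is then a
deterministic positive time, at which `B` almost surely does not jump. -/
lemma firstPassageSup_ae_eq_firstPassageInf [IsProbabilityMeasure P] (hα : 0 < α) (hβ : 0 < β)
    (hA : IsStableSubordinator α A P) (hB : IsStableSubordinator β B P)
    (hAB : IndepFun (fun ω t => A t ω) (fun ω t => B t ω) P) {t : ℝ≥0} (ht : 0 < t) :
    (fun ω => firstPassageSup t (A · ω) (B · ω)) =ᵐ[P]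
      fun ω => firstPassageInf t (A · ω) (B · ω) := by
  have hAm : Measurable fun ω t => A t ω := measurable_pi_lambda _ hA.measurable
  have hBm : Measurable fun ω t => B t ω := measurable_pi_lambda _ hB.measurable
  have hset : MeasurableSet {p : (ℝ≥0 → ℝ) × (ℝ≥0 → ℝ) |
      firstPassageSup t p.1 p.2 = firstPassageInf t p.1 p.2} :=
    measurableSet_eq_fun (measurable_firstPassageSup t) (measurable_firstPassageInf t)
  have := Measure.isProbabilityMeasure_map (μ := P) hBm.aemeasurable
  have hprod : ∀ᵐ p ∂((P.map fun ω t => A t ω).prod (P.map fun ω t => B t ω)),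
      firstPassageSup t p.1 p.2 = firstPassageInf t p.1 p.2 := by
    rw [Measure.ae_prod_iff_ae_ae hset]
    have hae : MeasurableSet {a : ℝ≥0 → ℝ | ∀ᵐ b ∂(P.map fun ω t => B t ω),
        firstPassageSup t a b = firstPassageInf t a b} :=
      measurable_measure_prodMk_left hset.compl (measurableSet_singleton 0)
    refine (ae_map_iff hAm.aemeasurable hae).2 ?_
    filter_upwards [hA.ae_isSubordinatorPath hα] with ω ha
    refine (ae_map_iff hBm.aemeasurable (measurable_prodMk_left hset)).2 ?_
    filter_upwards [hB.ae_isSubordinatorPath hβ,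
      hB.ae_exists_lt_of_lt (ha.sInf_pos (NNReal.coe_pos.2 ht))] with ω' hb hleft
    exact (ha.firstPassageSup_eq_apply_sInf hb t hleft).trans
      (ha.apply_sInf_eq_firstPassageInf hb t)
  rw [← hAB.map_prod_eq_prod_map_map hAm.aemeasurable hBm.aemeasurable] at hprod
  exact ae_of_ae_map (hAm.prodMk hBm).aemeasurable hprod

lemma exitTime_timeChange_ae_eq_firstPassageInf [IsProbabilityMeasure P] (hα : 0 < α) (hβ : 0 < β)
    (hA : IsStableSubordinator α A P) (hB : IsStableSubordinator β B P)
    (hAB : IndepFun (fun ω t => A t ω) (fun ω t => B t ω) P) {t : ℝ≥0} (ht : 0 < t) :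
    exitTime (timeChange A B) t =ᵐ[P] fun ω => firstPassageInf t (A · ω) (B · ω) := by
  filter_upwards [hA.ae_isSubordinatorPath hα, hB.ae_isSubordinatorPath hβ,
    firstPassageSup_ae_eq_firstPassageInf hα hβ hA hB hAB ht] with ω ha hb h
  exact (exitTime_timeChange_eq_firstPassageSup ha hb ht).trans h

end StableSubordinators

theorem lemma3 {Ω Ω' : Type*} [MeasurableSpace Ω] [MeasurableSpace Ω']
    (P : Measure Ω) [IsProbabilityMeasure P] (P' : Measure Ω') [IsProbabilityMeasure P']
    (α β : ℝ) (hα : α ∈ Set.Ioo (0 : ℝ) 1) (hβ : β ∈ Set.Ioo (0 : ℝ) 1)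
    -- independent stable subordinators of orders `α` and `β`, from which `A^α_{L^β}` is built
    (A B : ℝ≥0 → Ω → ℝ)
    (hA : IsStableSubordinator α A P) (hB : IsStableSubordinator β B P)
    (hAB : IndepFun (fun ω t => A t ω) (fun ω t => B t ω) P)
    -- independent stable subordinators of orders `α` and `β`, from which `A^β_{L^α}` is built
    (A' B' : ℝ≥0 → Ω' → ℝ)
    (hA' : IsStableSubordinator α A' P') (hB' : IsStableSubordinator β B' P')
    (hAB' : IndepFun (fun ω t => A' t ω) (fun ω t => B' t ω) P') :
    -- equality of the finite-dimensional distributions, at positive times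
    ∀ (n : ℕ) (t : Fin n → ℝ≥0), (∀ i, 0 < t i) →
      IdentDistrib
        (fun ω i => exitTime (timeChange A B) (t i) ω)
        (fun ω i => ((timeChange B' A' (t i) ω : ℝ) : EReal)) P P' := by
  intro n t ht
  have hmeas : Measurable fun (p : (ℝ≥0 → ℝ) × (ℝ≥0 → ℝ)) (i : Fin n) =>
      firstPassageInf (t i) p.1 p.2 :=
    measurable_pi_lambda _ fun i => measurable_firstPassageInf (t i)
  have hid := ((hA.identDistrib hA').prodMk (hB.identDistrib hB') hAB hAB').comp hmeas
  have h1 : (fun ω (i : Fin n) => exitTime (timeChange A B) (t i) ω) =ᵐ[P]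
      fun ω i => firstPassageInf (t i) (A · ω) (B · ω) := by
    filter_upwards [ae_all_iff.2 fun i =>
      exitTime_timeChange_ae_eq_firstPassageInf hα.1 hβ.1 hA hB hAB (ht i)] with ω hω
    exact funext hω
  have h2 : (fun ω (i : Fin n) => ((timeChange B' A' (t i) ω : ℝ) : EReal)) =ᵐ[P']
      fun ω i => firstPassageInf (t i) (A' · ω) (B' · ω) := by
    filter_upwards [ae_all_iff.2 fun i =>
      timeChange_ae_eq_firstPassageInf hα.1 hβ.1 hA' hB' (t i)] with ω hω
    exact funext hω
  exact ((IdentDistrib.of_ae_eq (hid.aemeasurable_fst.congr h1.symm) h1).trans hid).trans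
    (IdentDistrib.of_ae_eq hid.aemeasurable_snd h2.symm)
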